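/- Let $-\infty<a<b\le+\infty$ and $\mathcal M[y]=\frac1w\left(-(py')'+qy\right)$ on $[a,b)$, where $w>0$ and $p\ne0$ a.e., $p,q$ are complex-valued, $w,1/p,q\in L^1_{loc}[a,b)$, $Q=\overline{\mathrm{co}}\{q(x)/w(x)+rp(x): x\in[a,b),\,0<r<\infty\}\neq\mathbb C$, and $b$ is singular, i.e. $b=+\infty$ or $\int_a^b(w+1/|p|+|q|)\,dx=\infty$. Solutions of $\mathcal M[y]=\lambda y$ are functions $y$ with $y,py'$ locally absolutely continuous on $[a,b)$ which satisfy the equation a.e.; write $[u,v]=p(uv'-u'v)$ and $[u,v](b)=\lim_{x\to b}[u,v](x)$. Call $(\eta,K)\in\mathbb R\times\mathbb C$ admissible if $K$ is the nearest point of $Q$ to some $\lambda_0\in\mathbb C\setminus Q$, $\Re[(rp(x)+q(x)/w(x)-K)e^{i\eta}]\ge0$ for all $x\in[a,b)$, $0<r<\infty$, and $\Re[(\lambda_0-K)e^{i\eta}]<0$; put $\Lambda_{\eta,K}=\{\lambda\in\mathbb C:\Re[(\lambda-K)e^{i\eta}]\le0\}$. Let $\alpha\in\mathbb C$ and let $(\eta,K)$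 be admissible with $\Re[e^{i\eta}\cos\alpha\,\overline{\sin\alpha}]\le0$. Assume that the equation is in Sims Case II or III, i.e. that for some $\lambda\in\Lambda_{\eta,K}$ all solutions of $\mathcal M[y]=\lambda y$ lie in $L^2_w[a,b)$ and that either (Case II) up to constant multiples exactly one nontrivial solution, or (Case III) every solution, satisfies $$\int_a^b\Re\left[e^{i\eta}\{p|y'|^2+(q-Kw)|y|^2\}\right]dx+\int_a^b|y|^2w\,dx<\infty .$$ Let $\theta(\cdot,\lambda),\phi(\cdot,\lambda)$ be the solutions of $\mathcal M[y]=\lambda y$ with $\theta(a)=\cos\alpha$, $p\theta'(a)=\sin\alpha$, $\phi(a)=\sin\alpha$, $p\phi'(a)=-\cos\alpha$. Fix $\lambda'\in\Lambda_{\eta,K}$ and $m'\in\mathbb C$, and put $\psi=\theta(\cdot,\lambda')+m'\phi(\cdot,\lambda')$. Let $M$ be the realization of $\mathcal M$ in $L^2_w[a,b)$ with boundary conditions $y(a)\cos\alpha+py'(a)\sin\alpha=0$ and $[y,\psi](b)=0$, and let $L$ be the realization with boundary conditions $y(a)\sin\alpha-py'(a)\cos\alpha=0$ and $[y,\psi](b)=0$.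 Let $m(\lambda)$ be the number $m$ for which $\theta(\cdot,\lambda)+m\,\phi(\cdot,\lambda)$ lies in $L^2_w[a,b)$ and satisfies the boundary condition at $b$. Let $\ell(\lambda)$ be the number $\ell$ for which $\tilde\theta(\cdot,\lambda)+\ell\,\tilde\phi(\cdot,\lambda)$ does so, where $\tilde\theta,\tilde\phi$ are the solutions with $\tilde\theta(a)=\sin\alpha$, $p\tilde\theta'(a)=-\cos\alpha$, $\tilde\phi(a)=-\cos\alpha$, $p\tilde\phi'(a)=-\sin\alpha$. Let $a<b_n<b$, $b_n\nearrow b$, and let $m_n(\lambda)$, $\ell_n(\lambda)$ be the numbers for which $\theta(\cdot,\lambda)+m_n(\lambda)\phi(\cdot,\lambda)$, respectively $\tilde\theta(\cdot,\lambda)+\ell_n(\lambda)\tilde\phi(\cdot,\lambda)$, satisfies the truncated boundary condition $[y,\psi](b_n)=0$. Then: (i) $\lambda'$ is not an eigenvalue of $M$, and $m(\lambda')=m'$. (ii) Whenever $\beta_n,\kappa\in\mathbb C$ satisfy $(\cos\beta_n,\sin\beta_n)=\kappa\,(p\psi'(b_n),-\psi(b_n))$, the boundary condition $y(b_n)\cos\beta_n+py'(b_n)\sin\beta_n=0$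 is equivalent to $[y,\psi](b_n)=0$. (iii) For every $\lambda\in\mathbb C$ that is not an eigenvalue of $M$, $m(\lambda)$ exists and is unique, $m_n(\lambda)$ exists and is unique for all sufficiently large $n$, and $m_n(\lambda)\to m(\lambda)$ as $n\to\infty$. (iv) For every $\lambda\in\mathbb C$ that is not an eigenvalue of $L$, $\ell(\lambda)$ exists and is unique, $\ell_n(\lambda)$ exists and is unique for all sufficiently large $n$, and $\ell_n(\lambda)\to\ell(\lambda)$ as $n\to\infty$. -/

import Mathlib

open Filter Topology MeasureTheory Set

noncomputable section

/-- The data of a Sturm-Liouville expression `𝓜[y] = (1/w) (-(p y')' + q y)` on `[a, b)`,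
where `b` may be `+∞`. -/
structure SturmLiouville where
  a : ℝ
  b : EReal
  p : ℝ → ℂ
  q : ℝ → ℂ
  w : ℝ → ℝ

namespace SturmLiouville

variable (E : SturmLiouville)

/-- The half-open interval `[a, b)`. -/
def I : Set ℝ := {x | E.a ≤ x ∧ (x : EReal) < E.b}

/-- The filter `x → b` from the left (it is `atTop` if `b = +∞`). -/
def toEnd : Filter ℝ := comap (fun x : ℝ => (x : EReal)) (𝓝[<] E.b)

/-- `Q`, the closed convex hull of the values `q(x)/w(x) + r p(x)`, `x ∈ [a, b)`, `0 < r < ∞`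
(at the points where the quotient makes sense; `w > 0` almost everywhere). -/
def Q : Set ℂ :=
  closure (convexHull ℝ
    {z | ∃ x ∈ E.I, 0 < E.w x ∧ ∃ r : ℝ, 0 < r ∧ z = E.q x / (E.w x : ℂ) + (r : ℂ) * E.p x})

/-- The standing assumptions on the coefficients: `a < b`, `w > 0` and `p ≠ 0` a.e.,
`w, 1/p, q ∈ L¹_loc[a, b)`, `Q ≠ ℂ`, and `b` is a singular endpoint. -/
structure IsStandard : Prop where
  a_lt_b : (E.a : EReal) < E.b
  w_pos : ∀ᵐ x ∂volume.restrict E.I, 0 < E.w x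
  p_ne_zero : ∀ᵐ x ∂volume.restrict E.I, E.p x ≠ 0
  w_loc : LocallyIntegrableOn E.w E.I
  p_inv_loc : LocallyIntegrableOn (fun x => (E.p x)⁻¹) E.I
  q_loc : LocallyIntegrableOn E.q E.I
  Q_ne_univ : E.Q ≠ univ
  singular : E.b = ⊤ ∨ ¬ IntegrableOn (fun x => E.w x + ‖E.p x‖⁻¹ + ‖E.q x‖) E.I

/-- The set `S` of admissible pairs `(η, K)`: `K` is the nearest point of `Q` to some `z₀ ∉ Q`,
and after translating `K` to `0` and rotating by `η`, `Q` lies in the closed right half plane and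
`z₀` in the open left half plane. -/
def S : Set (ℝ × ℂ) :=
  {s | ∃ z₀ : ℂ, z₀ ∉ E.Q ∧ s.2 ∈ E.Q ∧ dist z₀ s.2 = Metric.infDist z₀ E.Q ∧
    (∀ x ∈ E.I, 0 < E.w x → ∀ r : ℝ, 0 < r →
      0 ≤ (((r : ℂ) * E.p x + E.q x / (E.w x : ℂ) - s.2) *
        Complex.exp (Complex.I * s.1)).re) ∧
    ((z₀ - s.2) * Complex.exp (Complex.I * s.1)).re < 0}

/-- The subset `S(α)` of those `(η, K) ∈ S` with `Re [e^{iη} cos α conj(sin α)] ≤ 0`. -/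
def SOf (α : ℂ) : Set (ℝ × ℂ) :=
  {s | s ∈ E.S ∧
    (Complex.exp (Complex.I * s.1) * Complex.cos α *
      (starRingEnd ℂ) (Complex.sin α)).re ≤ 0}

/-- The half plane `Λ_{η,K}`. -/
def Lam (η : ℝ) (K : ℂ) : Set ℂ := {z | ((z - K) * Complex.exp (Complex.I * η)).re ≤ 0}

/-- For a pair `Y = (y, u)`: `y` and `u` are locally absolutely continuous on `[a, b)`,
`u` is the quasi-derivative `p y'`, and `𝓜[y] = f`, i.e. `-(p y')' + q y = w f` a.e. -/
structure IsImage (Y : (ℝ → ℂ) × (ℝ → ℂ)) (f : ℝ → ℂ) : Prop where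
  ac_fst : ∀ x ∈ E.I, AbsolutelyContinuousOnInterval Y.1 E.a x
  ac_snd : ∀ x ∈ E.I, AbsolutelyContinuousOnInterval Y.2 E.a x
  deriv_fst : ∀ᵐ x ∂volume.restrict E.I, HasDerivAt Y.1 (Y.2 x / E.p x) x
  deriv_snd : ∀ᵐ x ∂volume.restrict E.I,
    HasDerivAt Y.2 (E.q x * Y.1 x - (E.w x : ℂ) * f x) x

/-- `Y = (y, p y')` solves `𝓜[y] = z y` on `[a, b)`. -/
def IsSolution (z : ℂ) (Y : (ℝ → ℂ) × (ℝ → ℂ)) : Prop :=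
  E.IsImage Y (fun x => z * Y.1 x)

/-- `f ∈ L²_w[a, b)`. -/
def MemL2w (f : ℝ → ℂ) : Prop :=
  MemLp f 2 ((volume.restrict E.I).withDensity (fun x => ENNReal.ofReal (E.w x)))

/-- The condition
`∫_a^b Re [e^{iη} (p |y'|² + (q - K w) |y|²)] dx + ∫_a^b |y|² w dx < ∞`
for `Y = (y, p y')`; for admissible `(η, K)` the first integrand is nonnegative. -/
def SimsFinite (η : ℝ) (K : ℂ) (Y : (ℝ → ℂ) × (ℝ → ℂ)) : Prop :=
  IntegrableOn (fun x => (Complex.exp (Complex.I * η) *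
      (E.p x * ((‖Y.2 x / E.p x‖ ^ 2 : ℝ) : ℂ) +
        (E.q x - K * (E.w x : ℂ)) * ((‖Y.1 x‖ ^ 2 : ℝ) : ℂ))).re) E.I ∧
  E.MemL2w Y.1

/-- Sims Case II with respect to `(η, K)`: all solutions lie in `L²_w[a, b)`, and up to constant
multiples there is exactly one nontrivial solution with the property `SimsFinite`. The
classification does not depend on the spectral parameter `z ∈ Λ_{η,K}`, so that it is enough to
ask this for one such `z`. -/
def SimsCaseII (η : ℝ) (K : ℂ) : Prop :=
  ∃ z ∈ Lam η K,
    (∀ Y, E.IsSolution z Y → E.MemL2w Y.1) ∧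
    ∃ Y₀, E.IsSolution z Y₀ ∧ (∃ x ∈ E.I, Y₀.1 x ≠ 0) ∧ E.SimsFinite η K Y₀ ∧
      ∀ Y, E.IsSolution z Y → E.SimsFinite η K Y → ∃ k : ℂ, ∀ x ∈ E.I, Y.1 x = k * Y₀.1 x

/-- Sims Case III with respect to `(η, K)`: all solutions lie in `L²_w[a, b)` and have the property
`SimsFinite` (for one, equivalently for all, `z ∈ Λ_{η,K}`). -/
def SimsCaseIII (η : ℝ) (K : ℂ) : Prop :=
  ∃ z ∈ Lam η K, ∀ Y, E.IsSolution z Y → E.MemL2w Y.1 ∧ E.SimsFinite η K Y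

/-- The solution `(y, p y')` of `𝓜[y] = z y` with `y(a) = y₀`, `(p y')(a) = u₀`
(it exists and is unique on `[a, b)` since `a` is a regular endpoint). -/
def ivp (z y₀ u₀ : ℂ) : (ℝ → ℂ) × (ℝ → ℂ) :=
  Classical.epsilon fun Y => E.IsSolution z Y ∧ Y.1 E.a = y₀ ∧ Y.2 E.a = u₀

/-- For the boundary condition `c y(a) + s (p y')(a) = 0`: the solution `θ(·, z)`, with
`θ(a) = c`, `pθ'(a) = s`. -/
def theta (c s z : ℂ) : (ℝ → ℂ) × (ℝ → ℂ) := E.ivp z c s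

/-- For the boundary condition `c y(a) + s (p y')(a) = 0`: the solution `φ(·, z)`, with
`φ(a) = s`, `pφ'(a) = -c`, which satisfies that boundary condition. -/
def phi (c s z : ℂ) : (ℝ → ℂ) × (ℝ → ℂ) := E.ivp z s (-c)

/-- `ψ = θ(·, z) + m φ(·, z)`, together with its quasi-derivative. -/
def psi (c s z m : ℂ) : (ℝ → ℂ) × (ℝ → ℂ) := E.theta c s z + m • E.phi c s z

/-- The Wronskian `[u, v] = p (u v' - u' v)`, for `U = (u, p u')` and `V = (v, p v')`. -/
def wronskian (U V : (ℝ → ℂ) × (ℝ → ℂ)) (x : ℝ) : ℂ := U.1 x * V.2 x - U.2 x * V.1 x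

/-- The boundary condition `[y, Ψ](b) = 0`, with `[y, Ψ](b) = lim_{x → b} [y, Ψ](x)`. -/
def BCAtEnd (Ψ Y : (ℝ → ℂ) × (ℝ → ℂ)) : Prop :=
  Tendsto (fun x => wronskian Y Ψ x) E.toEnd (𝓝 0)

/-- `y` lies in the domain of the realization of `𝓜` in `L²_w[a, b)` with boundary conditions
`c y(a) + s (p y')(a) = 0` and `[y, Ψ](b) = 0`, and is mapped to `f`. -/
structure IsRealizationGraph (c s : ℂ) (Ψ : (ℝ → ℂ) × (ℝ → ℂ))
    (Y : (ℝ → ℂ) × (ℝ → ℂ)) (f : ℝ → ℂ) : Prop where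
  image : E.IsImage Y f
  mem_domain : E.MemL2w Y.1
  mem_range : E.MemL2w f
  bc_a : c * Y.1 E.a + s * Y.2 E.a = 0
  bc_b : E.BCAtEnd Ψ Y

/-- `z` is an eigenvalue of that realization. -/
def IsEigenvalue (c s : ℂ) (Ψ : (ℝ → ℂ) × (ℝ → ℂ)) (z : ℂ) : Prop :=
  ∃ Y, E.IsRealizationGraph c s Ψ Y (fun x => z * Y.1 x) ∧ ∃ x ∈ E.I, Y.1 x ≠ 0

/-- `m` is a value at `z` of the Titchmarsh-Weyl function of that realization:
`θ(·, z) + m φ(·, z)` lies in `L²_w[a, b)` and satisfies the boundary condition at `b`. -/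
def IsTWValue (c s : ℂ) (Ψ : (ℝ → ℂ) × (ℝ → ℂ)) (z m : ℂ) : Prop :=
  E.MemL2w (E.psi c s z m).1 ∧ E.BCAtEnd Ψ (E.psi c s z m)

/-- The Titchmarsh-Weyl function of that realization (where it is defined). -/
def twFunction (c s : ℂ) (Ψ : (ℝ → ℂ) × (ℝ → ℂ)) (z : ℂ) : ℂ :=
  Classical.epsilon fun m => E.IsTWValue c s Ψ z m

/-- `m` is a value at `z` of the Titchmarsh-Weyl function of the regular problem on `[a, d]` with
boundary conditions `c y(a) + s (p y')(a) = 0` and `[y, Ψ](d) = 0`: the solution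
`θ(·, z) + m φ(·, z)` satisfies the boundary condition at `d`. -/
def IsTruncTWValue (c s : ℂ) (Ψ : (ℝ → ℂ) × (ℝ → ℂ)) (d : ℝ) (z m : ℂ) : Prop :=
  wronskian (E.psi c s z m) Ψ d = 0

/-- The Titchmarsh-Weyl function of the regular problem on `[a, d]` (where it is defined). -/
def truncTWFunction (c s : ℂ) (Ψ : (ℝ → ℂ) × (ℝ → ℂ)) (d : ℝ) (z : ℂ) : ℂ :=
  Classical.epsilon fun m => E.IsTruncTWValue c s Ψ d z m

end SturmLiouville

end

/-! Everything reduces to limits of Wronskians at `b`. In Case II or III all solutions lie in `L²_w`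
for one spectral parameter. Variation of parameters and Grönwall's inequality carry this over to
every parameter (`IsStandard.memL2w_of_forall`). For solutions `U`, `V` with parameters `z₁`, `z₂`,
Lagrange's identity `[U, V]' = (z₁ - z₂) w U V` has an integrable right-hand side, so `[U, V](x)`
converges as `x → b` (`IsStandard.tendsto_wronskian`).

Let `A` and `B` be the limits of `[θ(·, z), Ψ]` and `[φ(·, z), Ψ]`. The singular condition on `m`
reads `A + m B = 0`, and the truncated one is the same equation with the Wronskians taken at `bₙ`.
If `B = 0`, then `φ(·, z)` is an eigenfunction. Hence off the eigenvalues `m = -A / B`, and the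
truncated quotients converge to it (`IsStandard.tendsto_truncTWFunction`). Of the condition at `a`
only `c² + s² = 1` is needed, which covers `M` and `L` together.

At `z'` itself, Wronskians with `Ψ` are constant. An eigenfunction would therefore satisfy two
independent linear conditions at `a` and vanish, while `[Ψ, Ψ] = 0` gives `m(z') = m'`. -/

/-! ### Absolutely continuous functions and Grönwall's inequality. -/

section AbsolutelyContinuous

variable {F : Type*} [NormedAddCommGroup F] {a b : ℝ}

/-- The sums of increments of `g` are at most `C` times those of `f`. This serves for primitives,
exponentials and the addition of constants. -/
theorem AbsolutelyContinuousOnInterval.of_dist_le {X Y : Type*} [PseudoMetricSpace X]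
    [PseudoMetricSpace Y] {f : ℝ → X} {g : ℝ → Y} (hf : AbsolutelyContinuousOnInterval f a b)
    (C : ℝ)
    (h : ∀ x ∈ uIcc a b, ∀ y ∈ uIcc a b, dist (g x) (g y) ≤ C * dist (f x) (f y)) :
    AbsolutelyContinuousOnInterval g a b := by
  have hC : Tendsto (fun E : ℕ × (ℕ → ℝ × ℝ) ↦
      C * ∑ i ∈ Finset.range E.1, dist (f (E.2 i).1) (f (E.2 i).2))
      (AbsolutelyContinuousOnInterval.totalLengthFilter ⊓
        𝓟 (AbsolutelyContinuousOnInterval.disjWithin a b)) (𝓝 0) := by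
    simpa using Tendsto.const_mul C hf
  refine squeeze_zero' (Eventually.of_forall fun E ↦ Finset.sum_nonneg fun _ _ ↦ dist_nonneg) ?_ hC
  filter_upwards [mem_inf_of_right (mem_principal_self _)] with E hE
  rw [Finset.mul_sum]
  exact Finset.sum_le_sum fun i hi ↦ h _ (hE.1 i hi).1 _ (hE.1 i hi).2

/-- Increments are dominated by those of the primitive of `‖f‖`, which reduces the claim to the
scalar case. -/
theorem IntervalIntegrable.absolutelyContinuousOnInterval_primitive [NormedSpace ℝ F]
    {f : ℝ → F} (hf : IntervalIntegrable f volume a b) :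
    AbsolutelyContinuousOnInterval (fun x ↦ ∫ t in a..x, f t) a b := by
  have hsub : ∀ x ∈ uIcc a b, IntervalIntegrable f volume a x := fun x hx ↦
    hf.mono_set (uIcc_subset_uIcc left_mem_uIcc hx)
  refine (hf.norm.absolutelyContinuousOnInterval_intervalIntegral left_mem_uIcc).of_dist_le 1 ?_
  intro x hx y hy
  rw [dist_comm, dist_comm (∫ t in a..x, ‖f t‖), dist_eq_norm, dist_eq_norm,
    intervalIntegral.integral_interval_sub_left (hsub y hy) (hsub x hx),
    intervalIntegral.integral_interval_sub_left (hsub y hy).norm (hsub x hx).norm, one_mul,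
    Real.norm_eq_abs]
  exact intervalIntegral.norm_integral_le_abs_integral_norm

/-- The difference of `f` and the primitive of `g` is absolutely continuous with derivative zero
a.e., hence constant. -/
theorem AbsolutelyContinuousOnInterval.eq_add_integral [NormedSpace ℝ F] [CompleteSpace F]
    {f g : ℝ → F} (hf : AbsolutelyContinuousOnInterval f a b)
    (hg : IntervalIntegrable g volume a b)
    (hfg : ∀ᵐ x, x ∈ uIcc a b → HasDerivAt f (g x) x) :
    f b = f a + ∫ t in a..b, g t := by
  obtain ⟨C, hC⟩ := (hf.sub hg.absolutelyContinuousOnInterval_primitive).const_of_ae_hasDerivAt_zero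
    (by
      filter_upwards [hfg, hg.ae_hasDerivAt_integral] with x h1 h2 hx
      simpa using (h1 hx).sub (h2 hx a left_mem_uIcc))
  have h1 := hC a left_mem_uIcc
  have h2 := hC b right_mem_uIcc
  simp only [Pi.sub_apply, intervalIntegral.integral_same, sub_zero] at h1 h2
  rw [h1, ← h2]
  abel

theorem AbsolutelyContinuousOnInterval.exp {k : ℝ → ℝ}
    (hk : AbsolutelyContinuousOnInterval k a b) :
    AbsolutelyContinuousOnInterval (fun x ↦ Real.exp (k x)) a b := by
  obtain ⟨M, hM⟩ := hk.exists_bound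
  obtain ⟨L, hL⟩ := (Real.contDiff_exp.contDiffOn (n := 1) (s := Icc (-M) M)).exists_lipschitzOnWith
    (by simp) (convex_Icc _ _) isCompact_Icc
  exact hk.of_dist_le L fun x hx y hy ↦
    hL.dist_le_mul _ (abs_le.1 (hM x hx)) _ (abs_le.1 (hM y hy))

/-- Grönwall's inequality in integral form, with an integrable kernel. -/
theorem le_mul_exp_integral_of_le_add_integral {κ g : ℝ → ℝ} {C : ℝ} (hab : a ≤ b)
    (hκ : IntervalIntegrable κ volume a b) (hκ0 : ∀ x ∈ Icc a b, 0 ≤ κ x)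
    (hg : ContinuousOn g (Icc a b))
    (h : ∀ x ∈ Icc a b, g x ≤ C + ∫ t in a..x, κ t * g t) :
    g b ≤ C * Real.exp (∫ t in a..b, κ t) := by
  rw [← uIcc_of_le hab] at hg hκ0 h
  have hκg : IntervalIntegrable (fun t ↦ κ t * g t) volume a b := hκ.mul_continuousOn hg
  set k : ℝ → ℝ := fun x ↦ ∫ t in a..x, κ t
  set G : ℝ → ℝ := fun x ↦ C + ∫ t in a..x, κ t * g t with hG
  have hk := hκ.absolutelyContinuousOnInterval_primitive
  have hGac : AbsolutelyContinuousOnInterval G a b :=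
    hκg.absolutelyContinuousOnInterval_primitive.of_dist_le 1 (by simp [G])
  have he : AbsolutelyContinuousOnInterval (fun x ↦ Real.exp (-k x)) a b := hk.fun_neg.exp
  have hint : IntervalIntegrable
      (fun x ↦ κ x * ((g x - G x) * Real.exp (-k x))) volume a b :=
    hκ.mul_continuousOn ((hg.sub hGac.continuousOn).mul he.continuousOn)
  -- `G` is the right-hand side of the assumed inequality and `k` the primitive of `κ`. Then `(G
  -- e^{-k})' = κ (g - G) e^{-k} ≤ 0` a.e., so `G e^{-k}` ends no higher than its initial value `C`.
  have key := (hGac.fun_mul he).eq_add_integral hint (by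
    filter_upwards [hκ.ae_hasDerivAt_integral, hκg.ae_hasDerivAt_integral] with x h1 h2 hx
    have d1 := (h1 hx a left_mem_uIcc).neg.exp
    have d2 := (h2 hx a left_mem_uIcc).const_add C
    refine (d2.mul d1).congr_deriv ?_
    simp only [G, k, Pi.neg_apply]
    ring)
  have hneg : ∫ x in a..b, κ x * ((g x - G x) * Real.exp (-k x)) ≤ 0 := by
    rw [intervalIntegral.integral_of_le hab]
    refine setIntegral_nonpos measurableSet_Ioc fun x hx ↦ ?_
    replace hx : x ∈ uIcc a b := uIcc_of_le hab ▸ Ioc_subset_Icc_self hx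
    exact mul_nonpos_of_nonneg_of_nonpos (hκ0 x hx)
      (mul_nonpos_of_nonpos_of_nonneg (sub_nonpos.2 (h x hx)) (Real.exp_pos _).le)
  have hk0 : k a = 0 := intervalIntegral.integral_same
  have hG0 : G a = C := by simp [G]
  rw [hk0, hG0] at key
  have h3 : G b * Real.exp (-k b) ≤ C := by simp at key; linarith
  calc g b ≤ G b := h b right_mem_uIcc
    _ = G b * Real.exp (-k b) * Real.exp (k b) := by
      rw [mul_assoc, ← Real.exp_add, neg_add_cancel, Real.exp_zero, mul_one]
    _ ≤ C * Real.exp (k b) := by gcongr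

theorem integral_mul_exp_two_mul_integral {κ : ℝ → ℝ} (hκ : IntervalIntegrable κ volume a b) :
    ∫ x in a..b, κ x * Real.exp (2 * ∫ t in a..x, κ t) =
      (Real.exp (2 * ∫ t in a..b, κ t) - 1) / 2 := by
  have hk := (hκ.absolutelyContinuousOnInterval_primitive.const_mul 2).exp
  have hint : IntervalIntegrable
      (fun x ↦ 2 * (κ x * Real.exp (2 * ∫ t in a..x, κ t))) volume a b :=
    (hκ.mul_continuousOn hk.continuousOn).const_mul 2
  have key := hk.eq_add_integral hint (by
    filter_upwards [hκ.ae_hasDerivAt_integral] with x h1 hx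
    exact ((h1 hx a left_mem_uIcc).const_mul 2).exp.congr_deriv (by ring))
  rw [intervalIntegral.integral_const_mul] at key
  simp at key
  linarith

end AbsolutelyContinuous

/-! ### Existence for linear systems with integrable coefficients. -/

section LinearSystem

/-- The increments of the Picard iteration for the system `y' = r u`, `u' = s y`. -/
noncomputable def picardTerm (r s : ℝ → ℂ) (a : ℝ) (y₀ u₀ : ℂ) : ℕ → (ℝ → ℂ) × (ℝ → ℂ)
  | 0 => (fun _ ↦ y₀, fun _ ↦ u₀)
  | n + 1 => (fun x ↦ ∫ t in a..x, r t * (picardTerm r s a y₀ u₀ n).2 t,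
      fun x ↦ ∫ t in a..x, s t * (picardTerm r s a y₀ u₀ n).1 t)

variable {r s : ℝ → ℂ} {a b : ℝ} {y₀ u₀ : ℂ}

theorem continuousOn_picardTerm (hr : IntervalIntegrable r volume a b)
    (hs : IntervalIntegrable s volume a b) (n : ℕ) :
    ContinuousOn (picardTerm r s a y₀ u₀ n).1 (uIcc a b) ∧
      ContinuousOn (picardTerm r s a y₀ u₀ n).2 (uIcc a b) := by
  induction n with
  | zero => exact ⟨continuousOn_const, continuousOn_const⟩
  | succ n ih =>
    exact ⟨(hr.mul_continuousOn ih.2).absolutelyContinuousOnInterval_primitive.continuousOn,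
      (hs.mul_continuousOn ih.1).absolutelyContinuousOnInterval_primitive.continuousOn⟩

/-- Since `κ e^{2k}` has primitive `e^{2k} / 2`, integration against a kernel bounded by `κ` halves
the constant in front of the weight `e^{2k}`. The Picard increments thus decay geometrically on the
whole interval, without a smallness condition. -/
theorem norm_integral_mul_le_of_le_exp {r : ℝ → ℂ} {f : ℝ → ℂ} {κ : ℝ → ℝ} {M : ℝ} (hab : a ≤ b)
    (hM : 0 ≤ M) (hκ : IntervalIntegrable κ volume a b) (hrκ : ∀ t, ‖r t‖ ≤ κ t)
    (hf : ∀ t ∈ Icc a b, ‖f t‖ ≤ M * Real.exp (2 * ∫ τ in a..t, κ τ)) :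
    ‖∫ t in a..b, r t * f t‖ ≤ M / 2 * Real.exp (2 * ∫ τ in a..b, κ τ) := by
  have hk := (hκ.absolutelyContinuousOnInterval_primitive.const_mul 2).exp
  calc ‖∫ t in a..b, r t * f t‖
      ≤ ∫ t in a..b, M * (κ t * Real.exp (2 * ∫ τ in a..t, κ τ)) := by
        refine intervalIntegral.norm_integral_le_of_norm_le hab (ae_of_all _ fun t ht ↦ ?_)
          ((hκ.mul_continuousOn hk.continuousOn).const_mul M)
        rw [norm_mul]
        calc ‖r t‖ * ‖f t‖ ≤ κ t * (M * Real.exp (2 * ∫ τ in a..t, κ τ)) :=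
              mul_le_mul (hrκ t) (hf t (Ioc_subset_Icc_self ht)) (norm_nonneg _)
                ((norm_nonneg _).trans (hrκ t))
          _ = _ := by ring
    _ = M * ((Real.exp (2 * ∫ t in a..b, κ t) - 1) / 2) := by
        rw [intervalIntegral.integral_const_mul, integral_mul_exp_two_mul_integral hκ]
    _ ≤ _ := by linarith

theorem norm_picardTerm_le (hr : IntervalIntegrable r volume a b)
    (hs : IntervalIntegrable s volume a b) (n : ℕ) :
    ∀ x ∈ Icc a b,
      ‖(picardTerm r s a y₀ u₀ n).1 x‖ ≤
        (‖y₀‖ + ‖u₀‖) / 2 ^ n * Real.exp (2 * ∫ t in a..x, (‖r t‖ + ‖s t‖)) ∧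
      ‖(picardTerm r s a y₀ u₀ n).2 x‖ ≤
        (‖y₀‖ + ‖u₀‖) / 2 ^ n * Real.exp (2 * ∫ t in a..x, (‖r t‖ + ‖s t‖)) := by
  induction n with
  | zero =>
    intro x hx
    have h1 : 1 ≤ Real.exp (2 * ∫ t in a..x, (‖r t‖ + ‖s t‖)) :=
      Real.one_le_exp (mul_nonneg zero_le_two
        (intervalIntegral.integral_nonneg hx.1 fun t _ ↦ by positivity))
    have h2 : ‖y₀‖ + ‖u₀‖ ≤
        (‖y₀‖ + ‖u₀‖) / 2 ^ 0 * Real.exp (2 * ∫ t in a..x, (‖r t‖ + ‖s t‖)) := by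
      rw [pow_zero, div_one]
      exact le_mul_of_one_le_right (by positivity) h1
    exact ⟨le_trans (le_add_of_nonneg_right (norm_nonneg _)) h2,
      le_trans (le_add_of_nonneg_left (norm_nonneg _)) h2⟩
  | succ n ih =>
    intro x hx
    have hκ : IntervalIntegrable (fun t ↦ ‖r t‖ + ‖s t‖) volume a x :=
      (hr.norm.add hs.norm).mono_set (uIcc_subset_uIcc left_mem_uIcc (Icc_subset_uIcc hx))
    have hpow : (‖y₀‖ + ‖u₀‖) / 2 ^ (n + 1) = (‖y₀‖ + ‖u₀‖) / 2 ^ n / 2 := by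
      rw [pow_succ, div_div]
    rw [hpow]
    exact ⟨norm_integral_mul_le_of_le_exp hx.1 (by positivity) hκ
        (fun t ↦ le_add_of_nonneg_right (norm_nonneg _))
        fun t ht ↦ (ih t ⟨ht.1, ht.2.trans hx.2⟩).2,
      norm_integral_mul_le_of_le_exp hx.1 (by positivity) hκ
        (fun t ↦ le_add_of_nonneg_left (norm_nonneg _))
        fun t ht ↦ (ih t ⟨ht.1, ht.2.trans hx.2⟩).1⟩

/-- A geometric majorant gives uniform convergence of the series and, multiplied by the integrable
`‖r‖`, dominated convergence for the exchange of sum and integral. -/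
theorem continuousOn_tsum_and_hasSum_integral {f : ℕ → ℝ → ℂ} {C : ℝ} (hab : a ≤ b)
    (hr : IntervalIntegrable r volume a b) (hf : ∀ n, ContinuousOn (f n) (Icc a b))
    (hC : ∀ n, ∀ x ∈ Icc a b, ‖f n x‖ ≤ C * (1 / 2) ^ n) :
    ContinuousOn (fun x ↦ ∑' n, f n x) (Icc a b) ∧
      HasSum (fun n ↦ ∫ t in a..b, r t * f n t) (∫ t in a..b, r t * ∑' n, f n t) := by
  have hsum : Summable fun n : ℕ ↦ C * (1 / 2 : ℝ) ^ n := summable_geometric_two.mul_left C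
  refine ⟨continuousOn_tsum hf hsum hC, ?_⟩
  have hsub : uIoc a b ⊆ Icc a b := by rw [uIoc_of_le hab]; exact Ioc_subset_Icc_self
  refine intervalIntegral.hasSum_integral_of_dominated_convergence
    (fun n t ↦ ‖r t‖ * (C * (1 / 2) ^ n)) (fun n ↦ ?_)
    (fun n ↦ ae_of_all _ fun t ht ↦ ?_) (ae_of_all _ fun t _ ↦ hsum.mul_left _) ?_
    (ae_of_all _ fun t ht ↦ ?_)
  · exact (hr.mul_continuousOn (uIcc_of_le hab ▸ hf n)).def'.aestronglyMeasurable
  · rw [norm_mul]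
    exact mul_le_mul_of_nonneg_left (hC n t (hsub ht)) (norm_nonneg _)
  · simp_rw [tsum_mul_left]
    exact hr.norm.mul_const _
  · exact (Summable.of_norm_bounded hsum fun n ↦ hC n t (hsub ht)).hasSum.mul_left _

/-- The sum of the Picard increments solves the integral equations of the system `y' = r u`,
`u' = s y`. -/
theorem picard_tsum_eq (hab : a ≤ b) (hr : IntervalIntegrable r volume a b)
    (hs : IntervalIntegrable s volume a b) :
    let y : ℝ → ℂ := fun x ↦ ∑' n, (picardTerm r s a y₀ u₀ n).1 x
    let u : ℝ → ℂ := fun x ↦ ∑' n, (picardTerm r s a y₀ u₀ n).2 x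
    ContinuousOn y (Icc a b) ∧ ContinuousOn u (Icc a b) ∧
      y b = y₀ + ∫ t in a..b, r t * u t ∧ u b = u₀ + ∫ t in a..b, s t * y t := by
  intro y u
  have hcont := continuousOn_picardTerm (y₀ := y₀) (u₀ := u₀) hr hs
  rw [uIcc_of_le hab] at hcont
  have hκ : IntervalIntegrable (fun t ↦ ‖r t‖ + ‖s t‖) volume a b := hr.norm.add hs.norm
  have hC : ∀ n, ∀ x ∈ Icc a b, (‖y₀‖ + ‖u₀‖) / 2 ^ n *
      Real.exp (2 * ∫ t in a..x, (‖r t‖ + ‖s t‖)) ≤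
        (‖y₀‖ + ‖u₀‖) * Real.exp (2 * ∫ t in a..b, (‖r t‖ + ‖s t‖)) * (1 / 2) ^ n := by
    intro n x hx
    have hmono : ∫ t in a..x, (‖r t‖ + ‖s t‖) ≤ ∫ t in a..b, (‖r t‖ + ‖s t‖) :=
      intervalIntegral.integral_mono_interval le_rfl hx.1 hx.2
        (ae_of_all _ fun t ↦ by simp only [Pi.zero_apply]; positivity) hκ
    rw [div_eq_mul_inv, one_div, inv_pow, mul_assoc, mul_assoc, mul_comm (Real.exp _)]
    gcongr
  have hb := norm_picardTerm_le (y₀ := y₀) (u₀ := u₀) hr hs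
  obtain ⟨hu, hu'⟩ := continuousOn_tsum_and_hasSum_integral hab hr (fun n ↦ (hcont n).2)
    fun n x hx ↦ ((hb n x hx).2).trans (hC n x hx)
  obtain ⟨hy, hy'⟩ := continuousOn_tsum_and_hasSum_integral hab hs (fun n ↦ (hcont n).1)
    fun n x hx ↦ ((hb n x hx).1).trans (hC n x hx)
  -- Increment `n + 1` of one component is the integral of increment `n` of the other, so adding the
  -- zeroth increment to the summed integrals gives the integral equations.
  exact ⟨hy, hu, (hu'.zero_add (f := fun n ↦ (picardTerm r s a y₀ u₀ n).1 b)).tsum_eq,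
    (hy'.zero_add (f := fun n ↦ (picardTerm r s a y₀ u₀ n).2 b)).tsum_eq⟩

end LinearSystem

namespace SturmLiouville

variable {E : SturmLiouville}

/-! ### The interval `[a, b)` and its endpoint `b`. -/

section Interval

theorem measurableSet_I : MeasurableSet E.I :=
  measurableSet_Ici.inter (measurable_coe_real_ereal measurableSet_Iio)

theorem Icc_subset_I {x : ℝ} (hx : x ∈ E.I) : Icc E.a x ⊆ E.I :=
  fun _ ht ↦ ⟨ht.1, (EReal.coe_le_coe_iff.2 ht.2).trans_lt hx.2⟩

theorem uIcc_subset_I {x : ℝ} (hx : x ∈ E.I) : uIcc E.a x ⊆ E.I := by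
  rw [uIcc_of_le hx.1]
  exact Icc_subset_I hx

theorem exists_rat_mem_I_gt {x : ℝ} (hx : x ∈ E.I) : ∃ t : ℚ, (t : ℝ) ∈ E.I ∧ x < t := by
  obtain ⟨t, h1, h2⟩ := EReal.lt_iff_exists_rat_btwn.1 hx.2
  have h3 : x < (t : ℝ) := EReal.coe_lt_coe_iff.1 h1
  exact ⟨t, ⟨hx.1.trans h3.le, h2⟩, h3⟩

/-- Countably many intervals `[a, r]` with `r` rational exhaust `[a, b)`, so the exceptional null
sets can be united. -/
theorem ae_restrict_I_iff {P : ℝ → Prop} :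
    (∀ᵐ x ∂volume.restrict E.I, P x) ↔ ∀ x ∈ E.I, ∀ᵐ t, t ∈ uIcc E.a x → P t := by
  rw [ae_restrict_iff' measurableSet_I]
  refine ⟨fun h x hx ↦ h.mono fun t ht htx ↦ ht (uIcc_subset_I hx htx), fun h ↦ ?_⟩
  have h' : ∀ᵐ t, ∀ r : ℚ, (r : ℝ) ∈ E.I → t ∈ uIcc E.a r → P t := by
    rw [ae_all_iff]
    intro r
    by_cases hr : (r : ℝ) ∈ E.I
    · exact (h r hr).mono fun t ht _ ↦ ht
    · exact ae_of_all _ fun t ht ↦ absurd ht hr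
  filter_upwards [h'] with t ht htI
  obtain ⟨r, hr, htr⟩ := exists_rat_mem_I_gt htI
  exact ht r hr (Icc_subset_uIcc ⟨htI.1, htr.le⟩)

theorem intervalIntegrable_of_mem_I {F : Type*} [NormedAddCommGroup F] {f : ℝ → F}
    (hf : LocallyIntegrableOn f E.I) {x : ℝ} (hx : x ∈ E.I) :
    IntervalIntegrable f volume E.a x :=
  (hf.integrableOn_compact_subset (uIcc_subset_I hx) isCompact_uIcc).intervalIntegrable

theorem continuousOn_I {f : ℝ → ℂ} (hf : ∀ x ∈ E.I, ContinuousOn f (uIcc E.a x)) :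
    ContinuousOn f E.I := by
  intro t ht
  obtain ⟨r, hr, htr⟩ := exists_rat_mem_I_gt ht
  refine (hf r hr t (Icc_subset_uIcc ⟨ht.1, htr.le⟩)).mono_of_mem_nhdsWithin ?_
  filter_upwards [self_mem_nhdsWithin, mem_nhdsWithin_of_mem_nhds (Iic_mem_nhds htr)] with y h1 h2
  exact Icc_subset_uIcc ⟨h1.1, h2⟩

theorem IsStandard.a_mem_I (hE : E.IsStandard) : E.a ∈ E.I := ⟨le_rfl, hE.a_lt_b⟩

theorem tendsto_toEnd {bn : ℕ → ℝ} (hlt : ∀ n, (bn n : EReal) < E.b)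
    (hlim : Tendsto (fun n ↦ (bn n : EReal)) atTop (𝓝 E.b)) : Tendsto bn atTop E.toEnd :=
  tendsto_comap_iff.2 (tendsto_nhdsWithin_iff.2 ⟨hlim, Eventually.of_forall hlt⟩)

theorem eventually_toEnd_gt {t : ℝ} (ht : (t : EReal) < E.b) :
    ∀ᶠ x in E.toEnd, t < x ∧ (x : EReal) < E.b := by
  have h : ∀ᶠ y in 𝓝[<] E.b, (t : EReal) < y ∧ y < E.b := by
    filter_upwards [self_mem_nhdsWithin, mem_nhdsWithin_of_mem_nhds (Ioi_mem_nhds ht)] with y h1 h2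
    exact ⟨h2, h1⟩
  exact (h.comap _).mono fun x hx ↦ ⟨EReal.coe_lt_coe_iff.1 hx.1, hx.2⟩

theorem IsStandard.eventually_toEnd_mem_I (hE : E.IsStandard) : ∀ᶠ x in E.toEnd, x ∈ E.I :=
  (eventually_toEnd_gt hE.a_lt_b).mono fun _ hx ↦ ⟨hx.1.le, hx.2⟩

theorem IsStandard.tendsto_integral_toEnd (hE : E.IsStandard) {f : ℝ → ℂ}
    (hf : IntegrableOn f E.I) :
    Tendsto (fun x ↦ ∫ t in E.a..x, f t) E.toEnd (𝓝 (∫ t in E.I, f t)) := by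
  -- Dominated convergence along a filter requires countable generation; the sets `Iic x` exhaust
  -- `[a, b)` as `x → b`.
  have : E.toEnd.IsCountablyGenerated := by unfold toEnd; infer_instance
  have hcover : AECover (volume.restrict E.I) E.toEnd (fun x ↦ Iic x) :=
    { ae_eventually_mem := by
        filter_upwards [ae_restrict_mem measurableSet_I] with t ht
        exact (eventually_toEnd_gt ht.2).mono fun x hx ↦ hx.1.le
      measurableSet := fun x ↦ measurableSet_Iic }
  refine (hcover.integral_tendsto_of_countably_generated hf).congr' ?_
  filter_upwards [hE.eventually_toEnd_mem_I] with x hx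
  rw [Measure.restrict_restrict measurableSet_Iic, intervalIntegral.integral_of_le hx.1,
    ← integral_Icc_eq_integral_Ioc]
  congr 2
  ext t
  exact ⟨fun h ↦ ⟨h.2.1, h.1⟩, fun h ↦ ⟨h.2, Icc_subset_I hx h⟩⟩

end Interval

/-! ### Initial value problems and Lagrange's identity. -/

section Solutions

variable {z z₁ z₂ : ℂ} {U V Y : (ℝ → ℂ) × (ℝ → ℂ)}

theorem IsStandard.zero_order_coeff_loc (hE : E.IsStandard) (z : ℂ) :
    LocallyIntegrableOn (fun x ↦ E.q x - z * (E.w x : ℂ)) E.I := by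
  intro x hx
  obtain ⟨s, hs, h1⟩ := hE.q_loc x hx
  obtain ⟨t, ht, h2⟩ := hE.w_loc x hx
  exact ⟨s ∩ t, inter_mem hs ht, (h1.mono_set inter_subset_left).sub
    ((h2.mono_set inter_subset_right).ofReal.const_mul z)⟩

theorem IsStandard.exists_isSolution (hE : E.IsStandard) (z y₀ u₀ : ℂ) :
    ∃ Y, E.IsSolution z Y ∧ Y.1 E.a = y₀ ∧ Y.2 E.a = u₀ := by
  set r : ℝ → ℂ := fun x ↦ (E.p x)⁻¹ with hr_def
  set s : ℝ → ℂ := fun x ↦ E.q x - z * (E.w x : ℂ) with hs_def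
  have hr : ∀ x ∈ E.I, IntervalIntegrable r volume E.a x :=
    fun x hx ↦ intervalIntegrable_of_mem_I hE.p_inv_loc hx
  have hs : ∀ x ∈ E.I, IntervalIntegrable s volume E.a x :=
    fun x hx ↦ intervalIntegrable_of_mem_I (hE.zero_order_coeff_loc z) hx
  set y : ℝ → ℂ := fun x ↦ ∑' n, (picardTerm r s E.a y₀ u₀ n).1 x with hy_def
  set u : ℝ → ℂ := fun x ↦ ∑' n, (picardTerm r s E.a y₀ u₀ n).2 x with hu_def
  have key : ∀ x ∈ E.I, ContinuousOn y (Icc E.a x) ∧ ContinuousOn u (Icc E.a x) ∧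
      y x = y₀ + ∫ t in E.a..x, r t * u t ∧ u x = u₀ + ∫ t in E.a..x, s t * y t :=
    fun x hx ↦ picard_tsum_eq hx.1 (hr x hx) (hs x hx)
  have hru : ∀ x ∈ E.I, IntervalIntegrable (fun t ↦ r t * u t) volume E.a x := fun x hx ↦
    (hr x hx).mul_continuousOn (uIcc_of_le hx.1 ▸ (key x hx).2.1)
  have hsy : ∀ x ∈ E.I, IntervalIntegrable (fun t ↦ s t * y t) volume E.a x := fun x hx ↦
    (hs x hx).mul_continuousOn (uIcc_of_le hx.1 ▸ (key x hx).1)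
  -- The primitives are taken as the solution, because they are differentiable a.e. by Lebesgue's
  -- theorem. They agree with the Picard series on `[a, b)`, which is used only to rewrite the
  -- derivatives. The series does not depend on the right endpoint, so no gluing is needed.
  refine ⟨(fun x ↦ y₀ + ∫ t in E.a..x, r t * u t, fun x ↦ u₀ + ∫ t in E.a..x, s t * y t),
    ⟨fun x hx ↦ ?_, fun x hx ↦ ?_, ?_, ?_⟩, by simp, by simp⟩
  · exact (hru x hx).absolutelyContinuousOnInterval_primitive.of_dist_le 1 (by simp)
  · exact (hsy x hx).absolutelyContinuousOnInterval_primitive.of_dist_le 1 (by simp)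
  · refine ae_restrict_I_iff.2 fun x hx ↦ ?_
    filter_upwards [(hru x hx).ae_hasDerivAt_integral] with t h ht
    refine ((h ht E.a left_mem_uIcc).const_add y₀).congr_deriv ?_
    rw [← (key t (uIcc_subset_I hx ht)).2.2.2, hr_def]
    ring
  · refine ae_restrict_I_iff.2 fun x hx ↦ ?_
    filter_upwards [(hsy x hx).ae_hasDerivAt_integral] with t h ht
    refine ((h ht E.a left_mem_uIcc).const_add u₀).congr_deriv ?_
    rw [← (key t (uIcc_subset_I hx ht)).2.2.1, hs_def]
    ring

theorem IsStandard.ivp_spec (hE : E.IsStandard) (z y₀ u₀ : ℂ) :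
    E.IsSolution z (E.ivp z y₀ u₀) ∧ (E.ivp z y₀ u₀).1 E.a = y₀ ∧ (E.ivp z y₀ u₀).2 E.a = u₀ :=
  Classical.epsilon_spec (hE.exists_isSolution z y₀ u₀)

theorem IsSolution.add_smul (hU : E.IsSolution z U) (hV : E.IsSolution z V) (m : ℂ) :
    E.IsSolution z (U + m • V) where
  ac_fst x hx := (hU.ac_fst x hx).add ((hV.ac_fst x hx).const_smul m)
  ac_snd x hx := (hU.ac_snd x hx).add ((hV.ac_snd x hx).const_smul m)
  deriv_fst := by
    filter_upwards [hU.deriv_fst, hV.deriv_fst] with x h1 h2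
    refine (h1.add (h2.const_smul m)).congr_deriv ?_
    simp only [Prod.snd_add, Prod.smul_snd, Pi.add_apply, Pi.smul_apply, smul_eq_mul]
    ring
  deriv_snd := by
    filter_upwards [hU.deriv_snd, hV.deriv_snd] with x h1 h2
    refine (h1.add (h2.const_smul m)).congr_deriv ?_
    simp only [Prod.fst_add, Prod.smul_fst, Pi.add_apply, Pi.smul_apply, smul_eq_mul]
    ring

theorem IsSolution.fst_eq (hE : E.IsStandard) (hY : E.IsSolution z Y) {x : ℝ} (hx : x ∈ E.I) :
    Y.1 x = Y.1 E.a + ∫ t in E.a..x, (E.p t)⁻¹ * Y.2 t := by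
  refine (hY.ac_fst x hx).eq_add_integral
    ((intervalIntegrable_of_mem_I hE.p_inv_loc hx).mul_continuousOn
      (hY.ac_snd x hx).continuousOn) ?_
  filter_upwards [ae_restrict_I_iff.1 hY.deriv_fst x hx] with t h ht
  exact (h ht).congr_deriv (by ring)

theorem IsSolution.snd_eq (hE : E.IsStandard) (hY : E.IsSolution z Y) {x : ℝ} (hx : x ∈ E.I) :
    Y.2 x = Y.2 E.a + ∫ t in E.a..x, (E.q t - z * (E.w t : ℂ)) * Y.1 t := by
  refine (hY.ac_snd x hx).eq_add_integral
    ((intervalIntegrable_of_mem_I (hE.zero_order_coeff_loc z) hx).mul_continuousOn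
      (hY.ac_fst x hx).continuousOn) ?_
  filter_upwards [ae_restrict_I_iff.1 hY.deriv_snd x hx] with t h ht
  exact (h ht).congr_deriv (by ring)

theorem norm_integral_mul_le_of_norm_le {r f : ℝ → ℂ} {κ g : ℝ → ℝ} {a b : ℝ} (hab : a ≤ b)
    (hκg : IntervalIntegrable (fun t ↦ κ t * g t) volume a b)
    (hr : ∀ t ∈ Icc a b, ‖r t‖ ≤ κ t) (hf : ∀ t ∈ Icc a b, ‖f t‖ ≤ g t) :
    ‖∫ t in a..b, r t * f t‖ ≤ ∫ t in a..b, κ t * g t := by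
  refine intervalIntegral.norm_integral_le_of_norm_le hab (ae_of_all _ fun t ht ↦ ?_) hκg
  replace ht := Ioc_subset_Icc_self ht
  rw [norm_mul]
  exact mul_le_mul (hr t ht) (hf t ht) (norm_nonneg _) ((norm_nonneg _).trans (hr t ht))

/-- Uniqueness comes from Grönwall with initial constant `0`, applied to `‖y‖ + ‖p y'‖` with kernel
`‖1/p‖ + ‖q - z w‖`. -/
theorem IsSolution.eq_zero (hE : E.IsStandard) (hY : E.IsSolution z Y) (h1 : Y.1 E.a = 0)
    (h2 : Y.2 E.a = 0) {x : ℝ} (hx : x ∈ E.I) : Y.1 x = 0 := by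
  have hr := intervalIntegrable_of_mem_I hE.p_inv_loc hx
  have hs := intervalIntegrable_of_mem_I (hE.zero_order_coeff_loc z) hx
  have hc1 : ContinuousOn Y.1 (Icc E.a x) := uIcc_of_le hx.1 ▸ (hY.ac_fst x hx).continuousOn
  have hc2 : ContinuousOn Y.2 (Icc E.a x) := uIcc_of_le hx.1 ▸ (hY.ac_snd x hx).continuousOn
  have hg1 : ContinuousOn (fun t ↦ ‖Y.1 t‖) (Icc E.a x) := hc1.norm
  have hg2 : ContinuousOn (fun t ↦ ‖Y.2 t‖) (Icc E.a x) := hc2.norm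
  have key := le_mul_exp_integral_of_le_add_integral
    (κ := fun t ↦ ‖(E.p t)⁻¹‖ + ‖E.q t - z * (E.w t : ℂ)‖)
    (g := fun t ↦ ‖Y.1 t‖ + ‖Y.2 t‖) (C := 0) hx.1 (hr.norm.add hs.norm)
    (fun t _ ↦ by positivity) (hg1.add hg2) (fun t ht ↦ by
      have htI := Icc_subset_I hx ht
      have hsub : uIcc E.a t ⊆ uIcc E.a x := uIcc_subset_uIcc left_mem_uIcc (Icc_subset_uIcc ht)
      have hsub' : uIcc E.a t ⊆ Icc E.a x := uIcc_of_le hx.1 ▸ hsub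
      have hi1 : IntervalIntegrable (fun τ ↦ ‖(E.p τ)⁻¹‖ * ‖Y.2 τ‖) volume E.a t :=
        (hr.norm.mono_set hsub).mul_continuousOn (hg2.mono hsub')
      have hi2 : IntervalIntegrable (fun τ ↦ ‖E.q τ - z * (E.w τ : ℂ)‖ * ‖Y.1 τ‖) volume E.a t :=
        (hs.norm.mono_set hsub).mul_continuousOn (hg1.mono hsub')
      have hi : IntervalIntegrable (fun τ ↦ (‖(E.p τ)⁻¹‖ + ‖E.q τ - z * (E.w τ : ℂ)‖) *
          (‖Y.1 τ‖ + ‖Y.2 τ‖)) volume E.a t :=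
        ((hr.norm.add hs.norm).mono_set hsub).mul_continuousOn ((hg1.add hg2).mono hsub')
      have e1 := norm_integral_mul_le_of_norm_le (r := fun τ ↦ (E.p τ)⁻¹) (f := Y.2)
        htI.1 hi1 (fun _ _ ↦ le_rfl) (fun _ _ ↦ le_rfl)
      have e2 := norm_integral_mul_le_of_norm_le (r := fun τ ↦ E.q τ - z * (E.w τ : ℂ)) (f := Y.1)
        htI.1 hi2 (fun _ _ ↦ le_rfl) (fun _ _ ↦ le_rfl)
      rw [hY.fst_eq hE htI, hY.snd_eq hE htI, h1, h2, zero_add, zero_add, zero_add]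
      refine (add_le_add e1 e2).trans ?_
      rw [← intervalIntegral.integral_add hi1 hi2]
      refine intervalIntegral.integral_mono_on htI.1 (hi1.add hi2) hi fun τ _ ↦ ?_
      nlinarith [norm_nonneg (E.p τ)⁻¹, norm_nonneg (E.q τ - z * (E.w τ : ℂ)),
        norm_nonneg (Y.1 τ), norm_nonneg (Y.2 τ),
        mul_nonneg (norm_nonneg (E.p τ)⁻¹) (norm_nonneg (Y.1 τ)),
        mul_nonneg (norm_nonneg (E.q τ - z * (E.w τ : ℂ))) (norm_nonneg (Y.2 τ))])
  rw [zero_mul] at key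
  exact norm_le_zero_iff.1 ((le_add_of_nonneg_right (norm_nonneg _)).trans key)

/-- A solution whose first component vanishes has vanishing initial quasi-derivative. -/
theorem IsSolution.snd_eq_zero (hE : E.IsStandard) (hY : E.IsSolution z Y)
    (h : ∀ x ∈ E.I, Y.1 x = 0) : Y.2 E.a = 0 := by
  -- The derivative of `p y'` carries the factor `y = 0`, so `p y'` is constant. On an interval of
  -- positive length also `0 = y' = (p y') / p` a.e. with `p ≠ 0`, which forces the constant to
  -- vanish.
  have h' : ∀ x ∈ E.I, Y.2 x = Y.2 E.a := fun x hx ↦ by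
    rw [hY.snd_eq hE hx, add_eq_left]
    refine (intervalIntegral.integral_congr (g := fun _ ↦ 0) fun t ht ↦ ?_).trans (by simp)
    simp [h t (uIcc_subset_I hx ht)]
  obtain ⟨r, hr, har⟩ := exists_rat_mem_I_gt hE.a_mem_I
  have hpos : volume (Ioo E.a (r : ℝ)) ≠ 0 := by simp [har]
  have hae : ∀ᵐ t ∂volume.restrict E.I, t ∈ Ioo E.a (r : ℝ) → Y.2 E.a = 0 := by
    filter_upwards [hE.p_ne_zero, hY.deriv_fst, ae_restrict_mem measurableSet_I]
      with t hp hd htI ht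
    have h0 : Y.1 =ᶠ[𝓝 t] fun _ ↦ 0 := by
      filter_upwards [Ioo_mem_nhds ht.1 ht.2] with τ hτ
      exact h τ (Icc_subset_I hr ⟨hτ.1.le, hτ.2.le⟩)
    have := (h0.hasDerivAt_iff.1 hd).unique (hasDerivAt_const t 0)
    rw [div_eq_zero_iff, or_iff_left hp, h' t htI] at this
    exact this
  by_contra hne
  refine hpos (measure_mono_null (fun t ht ↦ ?_) ((ae_restrict_iff' measurableSet_I).1 hae))
  exact fun hc ↦ hne (hc (Icc_subset_I hr ⟨ht.1.le, ht.2.le⟩) ht)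

/-- Lagrange's identity: in `[U, V]'` the terms with `1/p` and `q` cancel and only the difference of
the spectral parameters remains. -/
theorem wronskian_eq (hE : E.IsStandard) (hU : E.IsSolution z₁ U) (hV : E.IsSolution z₂ V)
    {x : ℝ} (hx : x ∈ E.I) :
    wronskian U V x =
      wronskian U V E.a + ∫ t in E.a..x, (z₁ - z₂) * ((E.w t : ℂ) * (U.1 t * V.1 t)) := by
  have hw := intervalIntegrable_of_mem_I hE.w_loc hx
  have hw' : IntervalIntegrable (fun t ↦ (E.w t : ℂ)) volume E.a x := ⟨hw.1.ofReal, hw.2.ofReal⟩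
  have hint : IntervalIntegrable
      (fun t ↦ (z₁ - z₂) * ((E.w t : ℂ) * (U.1 t * V.1 t))) volume E.a x :=
    (hw'.mul_continuousOn
      ((hU.ac_fst x hx).continuousOn.mul (hV.ac_fst x hx).continuousOn)).const_mul _
  refine (((hU.ac_fst x hx).fun_smul (hV.ac_snd x hx)).fun_sub
    ((hU.ac_snd x hx).fun_smul (hV.ac_fst x hx))).eq_add_integral hint ?_
  filter_upwards [ae_restrict_I_iff.1 hU.deriv_fst x hx, ae_restrict_I_iff.1 hU.deriv_snd x hx,
    ae_restrict_I_iff.1 hV.deriv_fst x hx, ae_restrict_I_iff.1 hV.deriv_snd x hx]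
    with t h1 h2 h3 h4 ht
  refine (((h1 ht).mul (h4 ht)).sub ((h2 ht).mul (h3 ht))).congr_deriv ?_
  ring

theorem wronskian_add_smul_left (U V Y : (ℝ → ℂ) × (ℝ → ℂ)) (m : ℂ) (x : ℝ) :
    wronskian (U + m • V) Y x = wronskian U Y x + m * wronskian V Y x := by
  simp only [wronskian, Prod.fst_add, Prod.snd_add, Prod.smul_fst, Prod.smul_snd, Pi.add_apply,
    Pi.smul_apply, smul_eq_mul]
  ring

end Solutions

end SturmLiouville

namespace SturmLiouville

variable {E : SturmLiouville}

/-! ### Square integrability and limits of Wronskians at `b`. -/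

section SquareIntegrable

variable {z z₀ : ℂ} {U V Y : (ℝ → ℂ) × (ℝ → ℂ)} {f g : ℝ → ℂ}

theorem IsStandard.aestronglyMeasurable_w (hE : E.IsStandard) :
    AEStronglyMeasurable E.w (volume.restrict E.I) :=
  hE.w_loc.aestronglyMeasurable

/-- Integrability with respect to `w dx` is integrability of the product with `w`. -/
theorem IsStandard.integrable_withDensity_iff (hE : E.IsStandard) {F : Type*}
    [NormedAddCommGroup F] [NormedSpace ℝ F] {f : ℝ → F} :
    Integrable f ((volume.restrict E.I).withDensity fun x ↦ ENNReal.ofReal (E.w x)) ↔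
      IntegrableOn (fun x ↦ E.w x • f x) E.I := by
  rw [integrable_withDensity_iff_integrable_smul₀'
    hE.aestronglyMeasurable_w.aemeasurable.ennreal_ofReal (ae_of_all _ fun _ ↦ ENNReal.ofReal_lt_top)]
  refine integrable_congr ?_
  filter_upwards [hE.w_pos] with x hx
  rw [ENNReal.toReal_ofReal hx.le]

theorem IsStandard.integrableOn_mul (hE : E.IsStandard) (hf : E.MemL2w f) (hg : E.MemL2w g) :
    IntegrableOn (fun t ↦ (E.w t : ℂ) * (f t * g t)) E.I := by
  have := hE.integrable_withDensity_iff.1 (MemLp.integrable_mul hf hg)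
  simpa only [Complex.real_smul, Pi.mul_apply] using this

theorem IsStandard.integrableOn_sq (hE : E.IsStandard) (hf : E.MemL2w f) :
    IntegrableOn (fun t ↦ E.w t * ‖f t‖ ^ 2) E.I :=
  hE.integrable_withDensity_iff.1 (MemLp.integrable_norm_pow hf two_ne_zero)

theorem MemL2w.of_norm_le (hU : E.MemL2w f) (hV : E.MemL2w g) {h : ℝ → ℂ}
    (hh : ContinuousOn h E.I) (C : ℝ) (hle : ∀ x ∈ E.I, ‖h x‖ ≤ C * (‖f x‖ + ‖g x‖)) :
    E.MemL2w h := by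
  unfold MemL2w at *
  refine MemLp.of_le_mul (c := C) (hU.norm.add hV.norm)
    ((hh.aestronglyMeasurable measurableSet_I).mono_ac (withDensity_absolutelyContinuous _ _)) ?_
  refine (withDensity_absolutelyContinuous _ _).ae_le ?_
  filter_upwards [ae_restrict_mem measurableSet_I] with x hx
  rw [Pi.add_apply, Real.norm_of_nonneg (by positivity)]
  exact hle x hx

/-- The product of two functions in `L²_w` is integrable against `w`, so the integral in Lagrange's
identity converges at `b`. -/
theorem IsStandard.tendsto_wronskian (hE : E.IsStandard) {z₁ z₂ : ℂ} (hU : E.IsSolution z₁ U)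
    (hV : E.IsSolution z₂ V) (hU2 : E.MemL2w U.1) (hV2 : E.MemL2w V.1) :
    ∃ l, Tendsto (fun x ↦ wronskian U V x) E.toEnd (𝓝 l) := by
  refine ⟨_, ((hE.tendsto_integral_toEnd
    ((hE.integrableOn_mul hU2 hV2).const_mul (z₁ - z₂))).const_add
      (wronskian U V E.a)).congr' ?_⟩
  filter_upwards [hE.eventually_toEnd_mem_I] with x hx
  exact (wronskian_eq hE hU hV hx).symm

theorem wronskian_eq_of_same (hE : E.IsStandard) (hU : E.IsSolution z U) (hV : E.IsSolution z V)
    {x : ℝ} (hx : x ∈ E.I) : wronskian U V x = wronskian U V E.a := by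
  simp [wronskian_eq hE hU hV hx]

/-- Variation of parameters: the coefficients of a solution of `𝓜[y] = z y` with respect to a
fundamental system of `𝓜[y] = z₀ y` in `L²_w` stay bounded. -/
theorem IsStandard.memL2w_of_fundamental (hE : E.IsStandard) (hU : E.IsSolution z₀ U)
    (hV : E.IsSolution z₀ V) (hUV : wronskian U V E.a = 1) (hU2 : E.MemL2w U.1)
    (hV2 : E.MemL2w V.1) (hY : E.IsSolution z Y) : E.MemL2w Y.1 := by
  have hcU := continuousOn_I fun x hx ↦ (hU.ac_fst x hx).continuousOn
  have hcV := continuousOn_I fun x hx ↦ (hV.ac_fst x hx).continuousOn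
  have hcY := continuousOn_I fun x hx ↦ (hY.ac_fst x hx).continuousOn
  have hcW : ∀ {X : (ℝ → ℂ) × (ℝ → ℂ)}, E.IsSolution z₀ X → ContinuousOn (wronskian Y X) E.I :=
    fun hX ↦ (hcY.mul (continuousOn_I fun x hx ↦ (hX.ac_snd x hx).continuousOn)).sub
      ((continuousOn_I fun x hx ↦ (hY.ac_snd x hx).continuousOn).mul
        (continuousOn_I fun x hx ↦ (hX.ac_fst x hx).continuousOn))
  set h : ℝ → ℝ := fun x ↦ ‖U.1 x‖ + ‖V.1 x‖ with hh
  set g : ℝ → ℝ := fun x ↦ ‖wronskian Y U x‖ + ‖wronskian Y V x‖ with hg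
  -- The absolute value is there because `w` is positive only a.e., while the Grönwall kernel must
  -- be nonnegative everywhere.
  set κ : ℝ → ℝ := fun x ↦ ‖z - z₀‖ * (|E.w x| * h x ^ 2) with hκ
  have hκ0 : ∀ x, 0 ≤ κ x := fun x ↦ by positivity
  have hch : ContinuousOn h E.I := hcU.norm.add hcV.norm
  have hcg : ContinuousOn g E.I := (hcW hU).norm.add (hcW hV).norm
  have hYle : ∀ x ∈ E.I, ‖Y.1 x‖ ≤ h x * g x := by
    intro x hx
    -- Cramer's rule with `[U, V] = 1`: the coefficients of `Y` in the system `U`, `V` are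
    -- Wronskians.
    have h1 : Y.1 x = wronskian Y V x * U.1 x - wronskian Y U x * V.1 x := by
      have h2 : wronskian U V x = 1 := (wronskian_eq_of_same hE hU hV hx).trans hUV
      have h3 : wronskian Y V x * U.1 x - wronskian Y U x * V.1 x =
          Y.1 x * wronskian U V x := by simp only [wronskian]; ring
      rw [h3, h2, mul_one]
    rw [h1]
    refine (norm_sub_le _ _).trans ?_
    rw [norm_mul, norm_mul]
    simp only [h, g]
    nlinarith [mul_nonneg (norm_nonneg (U.1 x)) (norm_nonneg (wronskian Y U x)),
      mul_nonneg (norm_nonneg (V.1 x)) (norm_nonneg (wronskian Y V x))]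
  have hκint : IntegrableOn κ E.I := by
    have h1 : E.MemL2w fun x ↦ (h x : ℂ) :=
      MemL2w.of_norm_le hU2 hV2 (Complex.continuous_ofReal.comp_continuousOn hch) 1 fun x _ ↦ by
        rw [one_mul, Complex.norm_real, Real.norm_of_nonneg (by positivity)]
    refine Integrable.const_mul (Integrable.congr (hE.integrableOn_sq h1) ?_) _
    filter_upwards [hE.w_pos] with x hx
    rw [Complex.norm_real, Real.norm_eq_abs, sq_abs, abs_of_pos hx]
  have hw : ∀ x ∈ E.I, IntervalIntegrable κ volume E.a x := fun x hx ↦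
    intervalIntegrable_of_mem_I hκint.locallyIntegrableOn hx
  -- By Lagrange's identity the coefficients change at a rate at most `‖z - z₀‖ |w| ‖Y‖ ‖X‖` with `X
  -- = U, V`, and `‖Y‖ ≤ h g`. Summing over both gives the kernel `κ`; its integrability up to `b`
  -- makes the Grönwall bound uniform in `x`.
  have hbound : ∀ x ∈ E.I, g x ≤ g E.a * Real.exp (∫ t in E.I, κ t) := by
    intro x hx
    refine (le_mul_exp_integral_of_le_add_integral (C := g E.a) hx.1 (hw x hx) (fun t _ ↦ hκ0 t)
      (hcg.mono (Icc_subset_I hx)) fun t ht ↦ ?_).trans ?_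
    · have htI := Icc_subset_I hx ht
      have hsub : Icc E.a t ⊆ E.I := Icc_subset_I htI
      have hwi := intervalIntegrable_of_mem_I hE.w_loc htI
      have hpart : ∀ {X : (ℝ → ℂ) × (ℝ → ℂ)}, E.IsSolution z₀ X →
          IntervalIntegrable (fun τ ↦ ‖z - z₀‖ * |E.w τ| * (h τ * g τ * ‖X.1 τ‖))
            volume E.a t ∧
          ‖wronskian Y X t‖ ≤ ‖wronskian Y X E.a‖ +
            ∫ τ in E.a..t, ‖z - z₀‖ * |E.w τ| * (h τ * g τ * ‖X.1 τ‖) := by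
        intro X hX
        have hi : IntervalIntegrable (fun τ ↦ ‖z - z₀‖ * |E.w τ| * (h τ * g τ * ‖X.1 τ‖))
            volume E.a t :=
          (hwi.abs.const_mul _).mul_continuousOn (uIcc_of_le htI.1 ▸
            ((hch.mul hcg).mul (continuousOn_I fun x hx ↦
              (hX.ac_fst x hx).continuousOn).norm).mono hsub)
        refine ⟨hi, ?_⟩
        rw [wronskian_eq hE hY hX htI]
        refine (norm_add_le _ _).trans (add_le_add_right ?_ _)
        simp only [← mul_assoc (z - z₀)]
        refine norm_integral_mul_le_of_norm_le htI.1 hi (fun τ _ ↦ by simp) fun τ hτ ↦ ?_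
        rw [norm_mul]
        exact mul_le_mul_of_nonneg_right (hYle τ (hsub hτ)) (norm_nonneg _)
      obtain ⟨i1, b1⟩ := hpart hU
      obtain ⟨i2, b2⟩ := hpart hV
      have hsum : ∫ τ in E.a..t, κ τ * g τ =
          (∫ τ in E.a..t, ‖z - z₀‖ * |E.w τ| * (h τ * g τ * ‖U.1 τ‖)) +
            ∫ τ in E.a..t, ‖z - z₀‖ * |E.w τ| * (h τ * g τ * ‖V.1 τ‖) := by
        rw [← intervalIntegral.integral_add i1 i2]
        refine intervalIntegral.integral_congr fun τ _ ↦ ?_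
        simp only [κ, h]
        ring
      rw [hsum]
      simp only [g] at b1 b2 ⊢
      linarith
    · have hmono : ∫ t in E.a..x, κ t ≤ ∫ t in E.I, κ t := by
        rw [intervalIntegral.integral_of_le hx.1]
        exact setIntegral_mono_set hκint (ae_of_all _ hκ0)
          (Ioc_subset_Icc_self.trans (Icc_subset_I hx)).eventuallyLE
      gcongr
  refine MemL2w.of_norm_le hU2 hV2 hcY (g E.a * Real.exp (∫ t in E.I, κ t)) fun x hx ↦ ?_
  refine (hYle x hx).trans ?_
  rw [mul_comm]
  exact mul_le_mul_of_nonneg_right (hbound x hx) (by positivity)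

/-- If all solutions of `𝓜[y] = z₀ y` are in `L²_w`, then so are those of `𝓜[y] = z y`. -/
theorem IsStandard.memL2w_of_forall (hE : E.IsStandard)
    (h : ∀ Y, E.IsSolution z₀ Y → E.MemL2w Y.1) (hY : E.IsSolution z Y) : E.MemL2w Y.1 := by
  obtain ⟨h1, h2, h3⟩ := hE.ivp_spec z₀ 1 0
  obtain ⟨h4, h5, h6⟩ := hE.ivp_spec z₀ 0 1
  exact hE.memL2w_of_fundamental h1 h4 (by simp [wronskian, h2, h3, h5, h6]) (h _ h1) (h _ h4) hY

end SquareIntegrable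

/-! ### Titchmarsh–Weyl values as quotients of Wronskians. -/

section TitchmarshWeyl

variable {c s z z' m m' : ℂ} {Ψ Y : (ℝ → ℂ) × (ℝ → ℂ)}

theorem IsStandard.psi_isSolution (hE : E.IsStandard) (c s z m : ℂ) :
    E.IsSolution z (E.psi c s z m) :=
  (hE.ivp_spec z c s).1.add_smul (hE.ivp_spec z s (-c)).1 m

theorem wronskian_psi (c s z m : ℂ) (Ψ : (ℝ → ℂ) × (ℝ → ℂ)) (x : ℝ) :
    wronskian (E.psi c s z m) Ψ x =
      wronskian (E.theta c s z) Ψ x + m * wronskian (E.phi c s z) Ψ x :=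
  wronskian_add_smul_left _ _ _ _ _

theorem add_mul_eq_zero_iff {A B m : ℂ} (hB : B ≠ 0) : A + m * B = 0 ↔ m = -A / B := by
  rw [eq_div_iff hB, ← add_eq_zero_iff_eq_neg, add_comm]

theorem isTruncTWValue_neg_div_and_unique {d : ℝ} (hB : wronskian (E.phi c s z) Ψ d ≠ 0) :
    E.IsTruncTWValue c s Ψ d z
        (-wronskian (E.theta c s z) Ψ d / wronskian (E.phi c s z) Ψ d) ∧
      ∀ m, E.IsTruncTWValue c s Ψ d z m →
        m = -wronskian (E.theta c s z) Ψ d / wronskian (E.phi c s z) Ψ d := by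
  simp only [IsTruncTWValue, wronskian_psi, add_mul_eq_zero_iff hB, imp_self, implies_true,
    and_self]

/-- If `[φ(·, z), Ψ](b) = 0`, then `φ(·, z)` is an eigenfunction. -/
theorem IsStandard.isEigenvalue_of_tendsto (hE : E.IsStandard) (hcs : c ^ 2 + s ^ 2 = 1)
    (hφ : E.MemL2w (E.phi c s z).1) (h : E.BCAtEnd Ψ (E.phi c s z)) :
    E.IsEigenvalue c s Ψ z := by
  obtain ⟨h1, h2, h3⟩ := hE.ivp_spec z s (-c)
  refine ⟨E.phi c s z, ⟨h1, hφ, MemLp.const_mul hφ z, ?_, h⟩, ?_⟩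
  · simp only [phi, h2, h3]
    ring
  -- If `φ` vanished identically, both of its initial values `s` and `-c` would be zero, contrary to
  -- `c² + s² = 1`.
  · by_contra! hne
    have hc := IsSolution.snd_eq_zero hE h1 hne
    rw [h3, neg_eq_zero] at hc
    have hs : s = 0 := h2.symm.trans (hne E.a hE.a_mem_I)
    simp [hc, hs] at hcs

/-- The spectral parameter `z'` of the solution `Ψ = ψ(·, z', m')` that defines the boundary
condition at `b` is not an eigenvalue. -/
theorem IsStandard.not_isEigenvalue_psi [E.toEnd.NeBot] (hE : E.IsStandard)
    (hcs : c ^ 2 + s ^ 2 = 1) : ¬ E.IsEigenvalue c s (E.psi c s z' m') z' := by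
  rintro ⟨Y, hY, x, hx, hne⟩
  have hsol : E.IsSolution z' Y := hY.image
  have hΨ := hE.psi_isSolution c s z' m'
  obtain ⟨-, h2, h3⟩ := hE.ivp_spec z' s (-c)
  obtain ⟨-, h5, h6⟩ := hE.ivp_spec z' c s
  -- Both functions solve the equation with the same parameter, so their Wronskian is constant and
  -- equals its limit `0` at `b`.
  have hW : wronskian Y (E.psi c s z' m') E.a = 0 := by
    refine tendsto_nhds_unique (tendsto_const_nhds.congr' ?_) hY.bc_b
    filter_upwards [hE.eventually_toEnd_mem_I] with t ht
    exact (wronskian_eq_of_same hE hsol hΨ ht).symm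
  simp only [wronskian, psi, theta, phi, Prod.fst_add, Prod.snd_add, Prod.smul_fst,
    Prod.smul_snd, Pi.add_apply, Pi.smul_apply, smul_eq_mul, h2, h3, h5, h6] at hW
  have hbc := hY.bc_a
  -- The condition at `a` and `hW` form a linear system for the initial values of `Y`. Its
  -- determinant is `-(c² + s²) = -1` whatever `m'` is, and the multipliers are those of Cramer's
  -- rule.
  have e1 : Y.1 E.a = 0 := by linear_combination (-Y.1 E.a) * hcs + (c + m' * s) * hbc + s * hW
  have e2 : Y.2 E.a = 0 := by linear_combination (-Y.2 E.a) * hcs + (s - m' * c) * hbc - c * hW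
  exact hne (hsol.eq_zero hE e1 e2 hx)

/-- Away from eigenvalues the Titchmarsh-Weyl functions of the truncated problems are eventually
well defined, and they converge to that of the singular problem. -/
theorem IsStandard.tendsto_truncTWFunction (hE : E.IsStandard) (hcs : c ^ 2 + s ^ 2 = 1)
    (hL2 : ∀ Y, E.IsSolution z Y → E.MemL2w Y.1) (hΨ : E.IsSolution z' Ψ) (hΨ2 : E.MemL2w Ψ.1)
    (hz : ¬ E.IsEigenvalue c s Ψ z) {bn : ℕ → ℝ} (hbn : Tendsto bn atTop E.toEnd) :
    (∃! m, E.IsTWValue c s Ψ z m) ∧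
      (∀ᶠ n in atTop, ∃! m, E.IsTruncTWValue c s Ψ (bn n) z m) ∧
      Tendsto (fun n ↦ E.truncTWFunction c s Ψ (bn n) z) atTop (𝓝 (E.twFunction c s Ψ z)) := by
  have : E.toEnd.NeBot := hbn.neBot
  have hθ : E.IsSolution z (E.theta c s z) := (hE.ivp_spec z c s).1
  have hφ : E.IsSolution z (E.phi c s z) := (hE.ivp_spec z s (-c)).1
  obtain ⟨A, hA⟩ := hE.tendsto_wronskian hθ hΨ (hL2 _ hθ) hΨ2
  obtain ⟨B, hB⟩ := hE.tendsto_wronskian hφ hΨ (hL2 _ hφ) hΨ2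
  have hB0 : B ≠ 0 := by
    rintro rfl
    exact hz (hE.isEigenvalue_of_tendsto hcs (hL2 _ hφ) hB)
  -- Square integrability holds for every `m`, so only the vanishing of the limit `A + m * B`
  -- selects the value.
  have hval : ∀ m, E.IsTWValue c s Ψ z m ↔ m = -A / B := fun m ↦ by
    have hlim : Tendsto (fun x ↦ wronskian (E.psi c s z m) Ψ x) E.toEnd (𝓝 (A + m * B)) := by
      simp only [wronskian_psi]
      exact hA.add (hB.const_mul m)
    rw [← add_mul_eq_zero_iff hB0]
    refine ⟨fun h ↦ tendsto_nhds_unique hlim h.2,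
      fun h ↦ ⟨hL2 _ (hE.psi_isSolution c s z m), ?_⟩⟩
    rw [BCAtEnd, ← h]
    exact hlim
  have htw : E.twFunction c s Ψ z = -A / B :=
    (hval _).1 (Classical.epsilon_spec (p := fun m ↦ E.IsTWValue c s Ψ z m)
      ⟨-A / B, (hval _).2 rfl⟩)
  have hev : ∀ᶠ n in atTop, wronskian (E.phi c s z) Ψ (bn n) ≠ 0 :=
    (hB.comp hbn).eventually_ne hB0
  refine ⟨⟨-A / B, (hval _).2 rfl, fun m hm ↦ (hval m).1 hm⟩, ?_, ?_⟩
  · exact hev.mono fun n hn ↦ ⟨_, isTruncTWValue_neg_div_and_unique hn⟩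
  · rw [htw]
    refine Tendsto.congr' ?_ ((hA.comp hbn).neg.div (hB.comp hbn) hB0)
    filter_upwards [hev] with n hn
    obtain ⟨h1, h2⟩ := isTruncTWValue_neg_div_and_unique hn
    exact (h2 _ (Classical.epsilon_spec (p := fun m ↦ E.IsTruncTWValue c s Ψ (bn n) z m)
      ⟨_, h1⟩)).symm

end TitchmarshWeyl

/-- The two expressions differ by the factor `κ`, which is nonzero because `cos² β + sin² β = 1`. -/
theorem boundary_condition_iff {y u ψ₁ ψ₂ β κ : ℂ} (hc : Complex.cos β = κ * ψ₂)
    (hs : Complex.sin β = κ * -ψ₁) :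
    y * Complex.cos β + u * Complex.sin β = 0 ↔ y * ψ₂ - u * ψ₁ = 0 := by
  have hκ : κ ≠ 0 := by
    rintro rfl
    simpa [hc, hs] using Complex.sin_sq_add_cos_sq β
  have h : y * Complex.cos β + u * Complex.sin β = κ * (y * ψ₂ - u * ψ₁) := by
    rw [hc, hs]
    ring
  rw [h, mul_eq_zero, or_iff_right hκ]

end SturmLiouville

/-! ### The convergence theorem. -/

theorem mainTheorem8
    (E : SturmLiouville) (hE : E.IsStandard)
    (α : ℂ) (η : ℝ) (K : ℂ) (hS : (η, K) ∈ E.SOf α)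
    (hcase : E.SimsCaseII η K ∨ E.SimsCaseIII η K)
    -- the boundary condition at `b` is `[y, Ψ](b) = 0` with `Ψ = θ(·, z') + m' φ(·, z')`
    (z' : ℂ) (hz' : z' ∈ SturmLiouville.Lam η K) (m' : ℂ)
    (Ψ : (ℝ → ℂ) × (ℝ → ℂ)) (hΨ : Ψ = E.psi (Complex.cos α) (Complex.sin α) z' m')
    -- the truncation points `bₙ ↗ b`
    (bn : ℕ → ℝ) (hbn_mono : Monotone bn)
    (hbn_mem : ∀ n, E.a < bn n ∧ (bn n : EReal) < E.b)
    (hbn_lim : Filter.Tendsto (fun n => (bn n : EReal)) Filter.atTop (nhds E.b)) :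
    -- `m'` is the value `m(z')`, and `z'` is not an eigenvalue of `M`
    (¬ E.IsEigenvalue (Complex.cos α) (Complex.sin α) Ψ z' ∧
      E.twFunction (Complex.cos α) (Complex.sin α) Ψ z' = m') ∧
    -- a condition with `(cos βₙ, sin βₙ) = const (pψ'(bₙ), -ψ(bₙ))` is `[y, Ψ](bₙ) = 0`
    (∀ (n : ℕ) (β κ : ℂ), Complex.cos β = κ * Ψ.2 (bn n) → Complex.sin β = κ * (-Ψ.1 (bn n)) →
      ∀ Y : (ℝ → ℂ) × (ℝ → ℂ),
        Y.1 (bn n) * Complex.cos β + Y.2 (bn n) * Complex.sin β = 0 ↔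
          SturmLiouville.wronskian Y Ψ (bn n) = 0) ∧
    -- `mₙ(z) → m(z)` at every `z` which is not an eigenvalue of `M`
    (∀ z : ℂ, ¬ E.IsEigenvalue (Complex.cos α) (Complex.sin α) Ψ z →
      (∃! m, E.IsTWValue (Complex.cos α) (Complex.sin α) Ψ z m) ∧
      (∀ᶠ n in Filter.atTop,
        ∃! m, E.IsTruncTWValue (Complex.cos α) (Complex.sin α) Ψ (bn n) z m) ∧
      Filter.Tendsto
        (fun n => E.truncTWFunction (Complex.cos α) (Complex.sin α) Ψ (bn n) z) Filter.atTop
        (nhds (E.twFunction (Complex.cos α) (Complex.sin α) Ψ z))) ∧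
    -- `ℓₙ(z) → ℓ(z)` at every `z` which is not an eigenvalue of `L`, the realization with
    -- `sin α y(a) - cos α py'(a) = 0` and the same condition at `b`
    (∀ z : ℂ, ¬ E.IsEigenvalue (Complex.sin α) (-Complex.cos α) Ψ z →
      (∃! m, E.IsTWValue (Complex.sin α) (-Complex.cos α) Ψ z m) ∧
      (∀ᶠ n in Filter.atTop,
        ∃! m, E.IsTruncTWValue (Complex.sin α) (-Complex.cos α) Ψ (bn n) z m) ∧
      Filter.Tendsto
        (fun n => E.truncTWFunction (Complex.sin α) (-Complex.cos α) Ψ (bn n) z) Filter.atTop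
        (nhds (E.twFunction (Complex.sin α) (-Complex.cos α) Ψ z))) := by

  have hcs : Complex.cos α ^ 2 + Complex.sin α ^ 2 = 1 := Complex.cos_sq_add_sin_sq α
  -- Replacing `(c, s) = (cos α, sin α)` by `(sin α, -cos α)` turns `M`, `θ`, `φ` into `L`, `θ̃`,
  -- `φ̃`; the solution `Ψ` at `b` stays the same.
  have hcs' : Complex.sin α ^ 2 + (-Complex.cos α) ^ 2 = 1 := by
    rw [neg_sq, Complex.sin_sq_add_cos_sq]
  have hL2 : ∀ z Y, E.IsSolution z Y → E.MemL2w Y.1 := by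
    intro z Y hY
    rcases hcase with ⟨z₀, -, h, -⟩ | ⟨z₀, -, h⟩
    · exact hE.memL2w_of_forall h hY
    · exact hE.memL2w_of_forall (fun X hX ↦ (h X hX).1) hY
  have hbn := SturmLiouville.tendsto_toEnd (fun n ↦ (hbn_mem n).2) hbn_lim
  have : E.toEnd.NeBot := hbn.neBot
  have hΨsol : E.IsSolution z' Ψ := hΨ ▸ hE.psi_isSolution _ _ z' m'
  have hM := fun z hz ↦
    hE.tendsto_truncTWFunction (z := z) hcs (hL2 z) hΨsol (hL2 _ _ hΨsol) hz hbn
  have hz'_eig : ¬ E.IsEigenvalue (Complex.cos α) (Complex.sin α) Ψ z' :=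
    hΨ ▸ hE.not_isEigenvalue_psi hcs
  have hm' : E.IsTWValue (Complex.cos α) (Complex.sin α) Ψ z' m' := by
    rw [SturmLiouville.IsTWValue, ← hΨ]
    -- The Wronskian of `Ψ` with itself vanishes identically.
    refine ⟨hL2 _ _ hΨsol, tendsto_const_nhds.congr fun x ↦ ?_⟩
    simp only [SturmLiouville.wronskian]
    ring
  refine ⟨⟨hz'_eig, ?_⟩, fun n β κ hc hs Y ↦ SturmLiouville.boundary_condition_iff hc hs, hM,
    fun z hz ↦
      hE.tendsto_truncTWFunction hcs' (hL2 z) hΨsol (hL2 _ _ hΨsol) hz hbn⟩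
  exact (hM z' hz'_eig).1.unique (Classical.epsilon_spec
    (p := fun m ↦ E.IsTWValue (Complex.cos α) (Complex.sin α) Ψ z' m) ⟨m', hm'⟩) hm'
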